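/- Let $(E,d)$ be a Polish space with its Borel $\sigma$-field $\mathcal E$ and let $(P_t)_{t\ge 0}$ be a Markov semigroup on $E$, given by transition probabilities $P_t(x,A)$, $x\in E$, $A\in\mathcal E$, with $P_0(x,\cdot)=\delta_x$ and $P_{s+t}(x,A)=\int_E P_t(z,A)\,P_s(x,dz)$. Write $P_t\varphi(x)=\int_E\varphi(y)\,P_t(x,dy)$. Suppose that $(P_t)$ is locally weakly irreducible: there is $x_0\in E$ such that for all $R>0$ and $\varepsilon>0$ there is $T>0$ such that for all $t\ge T$ $$\inf_{x,y\in B_R(x_0)}\ \sup_{\Gamma\in\mathscr C(P_t(x,\cdot),P_t(y,\cdot))}\Gamma\bigl(\{(x',y')\in E\times E:\ d(x',y')\le\varepsilon\}\bigr)>0,$$ where $B_R(x_0)$ is the open ball and $\mathscr C(\mu,\nu)$ is the set of couplings of $\mu$ and $\nu$, that is, of probability measures on $E\times E$ with marginals $\mu$ and $\nu$. Suppose also that $(P_t)$ satisfies ASF+ with a bounded function $F$: $(P_t)$ is Feller (each $P_t$ maps bounded continuous functions to continuous functions), $F:[0,\infty)\to[0,\infty)$ is non-decreasing and bounded, and there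 are $x_1\in E$, a non-decreasing sequence $(t_n)$ in $[0,\infty)$ and positive numbers $\delta_n\searrow 0$ such that for every bounded function $\varphi:E\to\mathbb R$ that is $d$-Lipschitz with constant $K>0$, all $n$ and all $x,y\in E$ $$|P_{t_n}\varphi(x)-P_{t_n}\varphi(y)|\le d(x,y)\,F\bigl(d(x,x_1)\vee d(y,x_1)\bigr)\,\bigl(\|\varphi\|_\infty+\delta_nK\bigr).$$ Then $(P_t)$ has at most one invariant probability measure, that is, at most one probability measure $\mu$ on $(E,\mathcal E)$ with $\int_E P_t(x,A)\,\mu(dx)=\mu(A)$ for all $t\ge 0$ and $A\in\mathcal E$. -/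

import Mathlib

open MeasureTheory ProbabilityTheory Filter Topology
open scoped NNReal ENNReal BoundedContinuousFunction

/-- A Markov transition function `P t x A` on a measurable space `E`, with time in `[0, ∞)`:
Markov kernels with `P 0 x = δ_x` that satisfy the Chapman–Kolmogorov equations.
No regularity in the time variable is required. -/
structure MarkovSemigroup (E : Type*) [MeasurableSpace E] where
  /-- the transition kernels `x ↦ P_t(x, ·)` -/
  kernel : ℝ≥0 → Kernel E E
  isMarkov : ∀ t, IsMarkovKernel (kernel t)
  kernel_zero : kernel 0 = Kernel.id
  kernel_add : ∀ s t, kernel (s + t) = kernel t ∘ₖ kernel s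

namespace MarkovSemigroup

section Measurable

variable {E : Type*} [MeasurableSpace E]

/-- The action on functions, `(P_t φ)(x) = ∫ φ(y) P_t(x, dy)`. -/
noncomputable def apply (P : MarkovSemigroup E) (t : ℝ≥0) (φ : E → ℝ) (x : E) : ℝ :=
  ∫ y, φ y ∂(P.kernel t x)

/-- The measure `μ` is invariant: `∫ P_t(x, A) μ(dx) = μ(A)` for all `t ≥ 0` and measurable `A`. -/
def IsInvariant (P : MarkovSemigroup E) (μ : Measure E) : Prop :=
  ∀ t, (P.kernel t).Invariant μ

end Measurable

/-- The set of couplings of `μ` and `ν`: probability measures on `E × E` with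
marginals `μ` and `ν`. -/
def couplings {E : Type*} [MeasurableSpace E] (μ ν : Measure E) : Set (Measure (E × E)) :=
  {Γ | IsProbabilityMeasure Γ ∧ Γ.map Prod.fst = μ ∧ Γ.map Prod.snd = ν}

section Metric

variable {E : Type*} [MetricSpace E] [MeasurableSpace E]

/-- Feller: every `P_t` maps bounded continuous functions to continuous functions. -/
def IsFeller (P : MarkovSemigroup E) : Prop :=
  ∀ (t : ℝ≥0) (φ : E →ᵇ ℝ), Continuous (P.apply t φ)

/-- The asymptotic strong Feller plus property (ASF+) with the function `F`. The estimate is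
required of bounded Lipschitz functions `φ` only: for unbounded `φ` its right-hand side is
infinite. Here `‖φ‖` is the supremum norm. -/
def IsASFPlus (P : MarkovSemigroup E) (F : ℝ≥0 → ℝ≥0) : Prop :=
  P.IsFeller ∧ Monotone F ∧
    ∃ (x₀ : E) (t : ℕ → ℝ≥0) (δ : ℕ → ℝ),
      Monotone t ∧ (∀ n, 0 < δ n) ∧ Antitone δ ∧ Tendsto δ atTop (𝓝 0) ∧
      ∀ (φ : E →ᵇ ℝ) (K : ℝ≥0), 0 < K → LipschitzWith K φ →
        ∀ (n : ℕ) (x y : E),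
          |P.apply (t n) φ x - P.apply (t n) φ y| ≤
            dist x y * F (max (nndist x x₀) (nndist y x₀)) * (‖φ‖ + δ n * K)

/-- Local weak irreducibility. -/
def IsLocallyWeakIrreducible (P : MarkovSemigroup E) : Prop :=
  ∃ x₀ : E, ∀ R > (0 : ℝ), ∀ ε > (0 : ℝ), ∃ T > (0 : ℝ≥0), ∀ t ≥ T,
    0 < ⨅ x ∈ Metric.ball x₀ R, ⨅ y ∈ Metric.ball x₀ R,
      ⨆ Γ ∈ couplings (P.kernel t x) (P.kernel t y), Γ {z : E × E | dist z.1 z.2 ≤ ε}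

end Metric

end MarkovSemigroup

namespace MeasureTheory.Measure

variable {X : Type*} {mX : MeasurableSpace X}

/-! If `μ ≠ ν`, the positive and negative parts of `μ - ν` are nonzero, invariant
(`Kernel.Invariant.sub`) and mutually singular, so after normalisation it suffices to exclude
singular invariant probabilities (`not_mutuallySingular_of_isInvariant`). For these, a Lipschitz `φ`
makes `∫ φ dμ - ∫ φ dν` nearly 1. But from a ball charged by both, irreducibility couples the laws
at a time `T` so that close pairs have mass at least `a > 0`, and on close pairs ASF+ bounds the
oscillation of `P_{t_k} φ` by 1/2. Hence the difference stays below 1 by a margin `q` that does not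
depend on `φ` or `k`. -/

theorem sub_add_eq_sub_add (μ ν : Measure X) [IsFiniteMeasure μ] [IsFiniteMeasure ν] :
    μ - ν + ν = ν - μ + μ := by
  have h := sub_toSignedMeasure_eq_toSignedMeasure_sub (μ := μ) (ν := ν)
  rw [sub_eq_sub_iff_add_eq_add, ← toSignedMeasure_add, ← toSignedMeasure_add,
    toSignedMeasure_eq_toSignedMeasure_iff] at h
  rw [← h, add_comm]

/-- The positive part of the difference of two finite invariant measures is invariant. -/
theorem _root_.ProbabilityTheory.Kernel.Invariant.sub {κ : Kernel X X} [IsMarkovKernel κ]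
    {μ ν : Measure X} [IsFiniteMeasure μ] [IsFiniteMeasure ν]
    (hμ : κ.Invariant μ) (hν : κ.Invariant ν) : κ.Invariant (μ - ν) := by
  have hle : μ ≤ μ - ν + ν := by
    rw [sub_add_eq_sub_add]
    exact Measure.le_add_left le_rfl
  -- `μ - ν` is the least measure whose sum with `ν` dominates `μ`; its image under `κ` has this
  -- property too.
  have hsub : μ - ν ≤ κ ∘ₘ (μ - ν) := by
    refine sub_le_of_le_add ?_
    have hν' : κ ∘ₘ (μ - ν) + ν = κ ∘ₘ (μ - ν + ν) := by rw [comp_add, hν.def]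
    rw [hν']
    calc μ = κ ∘ₘ μ := hμ.def.symm
      _ ≤ κ ∘ₘ (μ - ν + ν) := by
        refine le_iff.mpr fun s hs => ?_
        rw [bind_apply hs κ.aemeasurable, bind_apply hs κ.aemeasurable]
        exact lintegral_mono' hle le_rfl
  -- A Markov kernel preserves total mass, which turns the inequality into equality.
  have huniv : (μ - ν) Set.univ = (κ ∘ₘ (μ - ν)) Set.univ := by
    simp [bind_apply .univ κ.aemeasurable]
  exact (eq_of_le_of_measure_univ_eq hsub huniv).symm

/-- An upper bound for the integral of a function that is at most `1` everywhere and at most `c`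
on a given set. -/
theorem integral_le_one_sub_mul {μ : Measure X} [IsProbabilityMeasure μ] {f : X → ℝ} {s : Set X}
    {c : ℝ} (hf : Integrable f μ) (hs : MeasurableSet s) (hone : ∀ x, f x ≤ 1)
    (hc : ∀ x ∈ s, f x ≤ c) : ∫ x, f x ∂μ ≤ 1 - (1 - c) * μ.real s := by
  have hind : Integrable (s.indicator fun _ => 1 - c) μ := (integrable_const _).indicator hs
  calc ∫ x, f x ∂μ ≤ ∫ x, (1 - s.indicator (fun _ => 1 - c) x) ∂μ := by
        refine integral_mono hf ((integrable_const _).sub hind) fun x => ?_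
        by_cases hx : x ∈ s
        · simpa [hx] using hc x hx
        · simpa [hx] using hone x
    _ = 1 - (1 - c) * μ.real s := by
        rw [integral_sub (integrable_const _) hind, integral_indicator hs]
        simp [mul_comm]

end MeasureTheory.Measure

/-- Mutually singular probability measures are almost separated by Lipschitz functions with values
in `[0, 1]`. -/
theorem MeasureTheory.Measure.MutuallySingular.exists_lipschitz_separating {E : Type*}
    [MetricSpace E] [PolishSpace E] [MeasurableSpace E] [BorelSpace E] {μ ν : Measure E}
    [IsProbabilityMeasure μ] [IsProbabilityMeasure ν] (h : μ.MutuallySingular ν)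
    {η : ℝ} (hη : 0 < η) :
    ∃ (φ : E →ᵇ ℝ) (K : ℝ≥0), LipschitzWith K φ ∧ (∀ x, 0 ≤ φ x) ∧ (∀ x, φ x ≤ 1) ∧
      1 - η < ∫ x, φ x ∂μ ∧ ∫ x, φ x ∂ν < η := by
  obtain ⟨s, hs, hμs, hνs⟩ := h
  have hη' : ENNReal.ofReal η ≠ 0 := by simpa using hη
  obtain ⟨A, hAs, hA, hμA⟩ := hs.compl.exists_isCompact_lt_add (measure_ne_top μ _) hη'
  obtain ⟨B, hBs, hB, hνB⟩ := hs.exists_isCompact_lt_add (measure_ne_top ν _) hη'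
  have hμs' : μ sᶜ = 1 := (prob_compl_eq_one_iff hs).mpr hμs
  have hνs' : ν s = 1 := by
    simpa using (prob_compl_eq_one_iff hs.compl).mpr hνs
  have hA' : 1 - η < μ.real A := by
    rw [hμs', ← ofReal_measureReal, ← ENNReal.ofReal_add measureReal_nonneg hη.le,
      ENNReal.one_lt_ofReal] at hμA
    linarith
  have hB' : 1 - η < ν.real B := by
    rw [hνs', ← ofReal_measureReal, ← ENNReal.ofReal_add measureReal_nonneg hη.le,
      ENNReal.one_lt_ofReal] at hνB
    linarith
  have hdisj : Disjoint A B := Set.disjoint_left.mpr fun x hxA hxB => hAs hxA (hBs hxB)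
  -- Disjoint compact sets lie at positive distance; this is what allows a Lipschitz separating
  -- function.
  obtain ⟨δ, hδ, hδdisj⟩ := hdisj.exists_thickenings hA hB.isClosed
  let g := thickenedIndicator hδ A
  have hg : LipschitzWith δ.toNNReal⁻¹ g := lipschitzWith_thickenedIndicator hδ A
  have hcoe : LipschitzWith 1 ((↑) : ℝ≥0 → ℝ) :=
    LipschitzWith.of_dist_le_mul fun x y => by simp [NNReal.dist_eq, Real.dist_eq]
  let φ : E →ᵇ ℝ := BoundedContinuousFunction.comp _ hcoe g
  have hφg : ∀ x, φ x = g x := fun _ => rfl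
  have h0 : ∀ x, 0 ≤ φ x := fun x => NNReal.coe_nonneg _
  have h1 : ∀ x, φ x ≤ 1 := fun x => by
    rw [hφg]
    exact_mod_cast thickenedIndicator_le_one hδ A x
  refine ⟨φ, 1 * δ.toNNReal⁻¹, hcoe.comp hg, h0, h1, ?_, ?_⟩
  · have hneg := Measure.integral_le_one_sub_mul (μ := μ) (f := fun x => 1 - φ x) (c := 0)
      ((integrable_const _).sub (φ.integrable μ)) hA.measurableSet
      (fun x => by linarith [h0 x]) (fun x hx => by
        rw [hφg, thickenedIndicator_one hδ A hx]; simp)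
    rw [integral_sub (integrable_const _) (φ.integrable μ)] at hneg
    simp only [integral_const, probReal_univ, smul_eq_mul] at hneg
    linarith
  · have hle := Measure.integral_le_one_sub_mul (μ := ν) (f := φ) (c := 0)
      (φ.integrable ν) hB.measurableSet h1 (fun x hx => by
        have hx' : x ∉ Metric.thickening δ A := fun hxA =>
          Set.disjoint_left.mp hδdisj hxA (Metric.self_subset_thickening hδ B hx)
        rw [hφg, thickenedIndicator_zero hδ A hx']; simp)
    linarith

namespace MarkovSemigroup

variable {E : Type*} [MeasurableSpace E]

instance (P : MarkovSemigroup E) (t : ℝ≥0) : IsMarkovKernel (P.kernel t) := P.isMarkov t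

theorem measurable_apply (P : MarkovSemigroup E) (t : ℝ≥0) {φ : E → ℝ} (hφ : Measurable φ) :
    Measurable (P.apply t φ) :=
  (hφ.stronglyMeasurable.integral_kernel (κ := P.kernel t)).measurable

theorem apply_nonneg (P : MarkovSemigroup E) (t : ℝ≥0) {φ : E → ℝ} (hφ : ∀ x, 0 ≤ φ x) (x : E) :
    0 ≤ P.apply t φ x :=
  integral_nonneg hφ

theorem apply_le_one (P : MarkovSemigroup E) (t : ℝ≥0) {φ : E → ℝ} (hm : Measurable φ)
    (h0 : ∀ x, 0 ≤ φ x) (h1 : ∀ x, φ x ≤ 1) (x : E) : P.apply t φ x ≤ 1 := by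
  have hint : Integrable φ (P.kernel t x) := .of_mem_Icc 0 1 hm.aemeasurable
    (ae_of_all _ fun y => ⟨h0 y, h1 y⟩)
  simpa [apply] using integral_mono hint (integrable_const 1) h1

theorem apply_add (P : MarkovSemigroup E) (s t : ℝ≥0) {φ : E → ℝ} (hm : Measurable φ)
    (h0 : ∀ x, 0 ≤ φ x) (h1 : ∀ x, φ x ≤ 1) (x : E) :
    P.apply (s + t) φ x = ∫ y, P.apply t φ y ∂(P.kernel s x) := by
  rw [apply, P.kernel_add, Kernel.integral_comp]
  · rfl
  · exact .of_mem_Icc 0 1 hm.aemeasurable (ae_of_all _ fun y => ⟨h0 y, h1 y⟩)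

theorem IsInvariant.integral_apply {P : MarkovSemigroup E} {μ : Measure E} [IsProbabilityMeasure μ]
    (hμ : P.IsInvariant μ) (t : ℝ≥0) {φ : E → ℝ} (hm : Measurable φ)
    (h0 : ∀ x, 0 ≤ φ x) (h1 : ∀ x, φ x ≤ 1) : ∫ x, P.apply t φ x ∂μ = ∫ x, φ x ∂μ := by
  have hcomp : μ = (P.kernel t ∘ₖ Kernel.const Unit μ) () := by
    rw [← Measure.comp_eq_comp_const_apply, (hμ t).def]
  conv_rhs => rw [hcomp]
  rw [Kernel.integral_comp]
  · rfl
  · exact .of_mem_Icc 0 1 hm.aemeasurable (ae_of_all _ fun y => ⟨h0 y, h1 y⟩)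

/-- For a coupling `Γ` of `μ` and `ν`, the difference of the integrals of a function with values in
`[0, 1]` is controlled by its oscillation on a set of pairs charged by `Γ`. -/
theorem integral_sub_integral_le_of_mem_couplings {μ ν : Measure E} {Γ : Measure (E × E)}
    (hΓ : Γ ∈ couplings μ ν) {f : E → ℝ} (hm : Measurable f) (h0 : ∀ x, 0 ≤ f x)
    (h1 : ∀ x, f x ≤ 1) {S : Set (E × E)} (hS : MeasurableSet S) {c : ℝ}
    (hc : ∀ z ∈ S, f z.1 - f z.2 ≤ c) :
    ∫ x, f x ∂μ - ∫ x, f x ∂ν ≤ 1 - (1 - c) * Γ.real S := by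
  obtain ⟨hprob, rfl, rfl⟩ := hΓ
  have hi1 : Integrable (fun z : E × E => f z.1) Γ :=
    .of_mem_Icc 0 1 (hm.comp measurable_fst).aemeasurable (ae_of_all _ fun z => ⟨h0 _, h1 _⟩)
  have hi2 : Integrable (fun z : E × E => f z.2) Γ :=
    .of_mem_Icc 0 1 (hm.comp measurable_snd).aemeasurable (ae_of_all _ fun z => ⟨h0 _, h1 _⟩)
  rw [integral_map measurable_fst.aemeasurable hm.aestronglyMeasurable,
    integral_map measurable_snd.aemeasurable hm.aestronglyMeasurable, ← integral_sub hi1 hi2]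
  exact Measure.integral_le_one_sub_mul (hi1.sub hi2) hS
    (fun z => by linarith [h0 z.2, h1 z.1]) hc

theorem prod_mem_couplings (μ ν : Measure E) [IsProbabilityMeasure μ] [IsProbabilityMeasure ν] :
    μ.prod ν ∈ couplings μ ν :=
  ⟨inferInstance, by simp, by simp⟩

/-- Under local weak irreducibility and ASF+ with a bounded function, two invariant probability
measures cannot be mutually singular. -/
theorem not_mutuallySingular_of_isInvariant {E : Type*} [MetricSpace E] [PolishSpace E]
    [MeasurableSpace E] [BorelSpace E]
    (P : MarkovSemigroup E) (hirr : P.IsLocallyWeakIrreducible)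
    (F : ℝ≥0 → ℝ≥0) (hASF : P.IsASFPlus F) (hF : BddAbove (Set.range F))
    (μ ν : Measure E) [IsProbabilityMeasure μ] [IsProbabilityMeasure ν]
    (hμ : P.IsInvariant μ) (hν : P.IsInvariant ν) : ¬ μ.MutuallySingular ν := by
  intro hsing
  obtain ⟨x₀, hirr⟩ := hirr
  obtain ⟨-, -, x₁, t, δ, -, hδ, -, hδlim, hest⟩ := hASF
  obtain ⟨M, hM⟩ := hF
  have hball (ρ : Measure E) [IsProbabilityMeasure ρ] : ∃ n : ℕ, ρ (Metric.ball x₀ n) ≠ 0 := by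
    by_contra! h
    have := measure_iUnion_null h
    simp [Metric.iUnion_ball_nat] at this
  obtain ⟨n, hn⟩ := hball μ
  obtain ⟨m, hm⟩ := hball ν
  let R : ℝ := n + m + 1
  have hμR : 0 < μ.real (Metric.ball x₀ R) := by
    refine ENNReal.toReal_pos (fun h => hn (measure_mono_null (Metric.ball_subset_ball ?_) h))
      (measure_ne_top _ _)
    simp only [R]; linarith [m.cast_nonneg (α := ℝ)]
  have hνR : 0 < ν.real (Metric.ball x₀ R) := by
    refine ENNReal.toReal_pos (fun h => hm (measure_mono_null (Metric.ball_subset_ball ?_) h))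
      (measure_ne_top _ _)
    simp only [R]; linarith [n.cast_nonneg (α := ℝ)]
  -- Chosen so that `ε * (M + 1) * 2 = 1 / 2`. As `F` is bounded, `ε` serves for close pairs
  -- anywhere in `E`, even far from the ball.
  let ε : ℝ := 1 / (4 * (M + 1))
  obtain ⟨T, -, hT⟩ := hirr R (by positivity) ε (by positivity)
  -- Strictly below the infimum, so that a coupling exceeding `a` exists even if the supremum is not
  -- attained.
  obtain ⟨a, ha0, ha⟩ := exists_between (hT T le_rfl)
  have ha_top : a ≠ ⊤ := ha.ne_top
  have ha_pos : 0 < a.toReal := ENNReal.toReal_pos ha0.ne' ha_top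
  let q := a.toReal / 2 * (μ.real (Metric.ball x₀ R) * ν.real (Metric.ball x₀ R))
  have hq : 0 < q := by positivity
  obtain ⟨φ, K, hK, h0, h1, hφμ, hφν⟩ := hsing.exists_lipschitz_separating (half_pos hq)
  have hKpos : 0 < K + 1 := by positivity
  -- `k` may depend on `φ`, since `T`, `a` and `q` are already fixed. `K + 1` replaces `K` because
  -- ASF+ asks for a positive constant.
  obtain ⟨k, hk⟩ := (hδlim.eventually_lt_const
    (show (0 : ℝ) < 1 / (K + 1 : ℝ≥0) by positivity)).exists
  have hφm : Measurable φ := φ.continuous.measurable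
  have hnorm : ‖φ‖ ≤ 1 := by
    refine (BoundedContinuousFunction.norm_le zero_le_one).mpr fun x => ?_
    rw [Real.norm_eq_abs, abs_of_nonneg (h0 x)]
    exact h1 x
  have hbr : ‖φ‖ + δ k * (K + 1 : ℝ≥0) ≤ 2 := by
    rw [lt_div_iff₀ (by exact_mod_cast hKpos)] at hk
    linarith
  have hclose (z : E × E) (hz : z ∈ {z : E × E | dist z.1 z.2 ≤ ε}) :
      P.apply (t k) φ z.1 - P.apply (t k) φ z.2 ≤ 1 / 2 := by
    refine (le_abs_self _).trans
      ((hest φ (K + 1) hKpos (hK.weaken (by simp)) k z.1 z.2).trans ?_)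
    have hFM : (F (max (nndist z.1 x₁) (nndist z.2 x₁)) : ℝ) ≤ M + 1 := by
      have : (F (max (nndist z.1 x₁) (nndist z.2 x₁)) : ℝ) ≤ M := by
        exact_mod_cast hM (Set.mem_range_self _)
      linarith
    have hpos : (0 : ℝ) ≤ ‖φ‖ + δ k * (K + 1 : ℝ≥0) :=
      add_nonneg (norm_nonneg _) (mul_nonneg (hδ k).le (NNReal.coe_nonneg _))
    calc dist z.1 z.2 * F (max (nndist z.1 x₁) (nndist z.2 x₁)) * (‖φ‖ + δ k * (K + 1 : ℝ≥0))
        ≤ ε * (M + 1) * 2 := by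
          have : dist z.1 z.2 ≤ ε := hz
          gcongr
      _ = 1 / 2 := by
          have : (M : ℝ) + 1 ≠ 0 := by positivity
          simp only [ε]; field_simp; norm_num
  have hpair (z : E × E) (hz : z ∈ Metric.ball x₀ R ×ˢ Metric.ball x₀ R) :
      P.apply (T + t k) φ z.1 - P.apply (T + t k) φ z.2 ≤ 1 - a.toReal / 2 := by
    have hlt := ha.trans_le ((iInf₂_le z.1 hz.1).trans (iInf₂_le z.2 hz.2))
    simp only [lt_iSup_iff] at hlt
    obtain ⟨Γ, hΓ, haΓ⟩ := hlt
    have := hΓ.1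
    have haΓ' : a.toReal ≤ Γ.real {z : E × E | dist z.1 z.2 ≤ ε} :=
      ENNReal.toReal_mono (measure_ne_top _ _) haΓ.le
    -- Couple up to time `T`, then let ASF+ act on `P_{t_k} φ`.
    rw [P.apply_add T (t k) hφm h0 h1, P.apply_add T (t k) hφm h0 h1]
    have := integral_sub_integral_le_of_mem_couplings hΓ (P.measurable_apply (t k) hφm)
      (P.apply_nonneg (t k) h0) (P.apply_le_one (t k) hφm h0 h1)
      (isClosed_le continuous_dist continuous_const).measurableSet hclose
    linarith
  -- Under the independent coupling the square of the ball has mass `μ(B) ν(B)`; invariance then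
  -- removes the semigroup.
  have hfinal := integral_sub_integral_le_of_mem_couplings (prod_mem_couplings μ ν)
    (P.measurable_apply (T + t k) hφm) (P.apply_nonneg (T + t k) h0)
    (P.apply_le_one (T + t k) hφm h0 h1)
    (Metric.isOpen_ball.measurableSet.prod Metric.isOpen_ball.measurableSet) hpair
  rw [hμ.integral_apply (T + t k) hφm h0 h1, hν.integral_apply (T + t k) hφm h0 h1,
    measureReal_prod_prod] at hfinal
  have : (1 - (1 - a.toReal / 2)) * (μ.real (Metric.ball x₀ R) * ν.real (Metric.ball x₀ R)) = q := by
    simp only [q]; ring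
  linarith

theorem IsInvariant.smul {P : MarkovSemigroup E} {μ : Measure E} (hμ : P.IsInvariant μ)
    (c : ℝ≥0∞) : P.IsInvariant (c • μ) := fun t => by
  rw [Kernel.Invariant, Measure.comp_smul, (hμ t).def]

end MarkovSemigroup

theorem theorem2p4 {E : Type*} [MetricSpace E] [PolishSpace E] [MeasurableSpace E] [BorelSpace E]
    (P : MarkovSemigroup E) (hirr : P.IsLocallyWeakIrreducible)
    (F : ℝ≥0 → ℝ≥0) (hASF : P.IsASFPlus F) (hF : BddAbove (Set.range F))
    (μ ν : Measure E) [IsProbabilityMeasure μ] [IsProbabilityMeasure ν]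
    (hμ : P.IsInvariant μ) (hν : P.IsInvariant ν) : μ = ν := by
  have hne {ρ σ : Measure E} [IsProbabilityMeasure ρ] [IsProbabilityMeasure σ] (h : ρ ≠ σ) :
      ρ - σ ≠ 0 := fun h0 => by
    have hadd := Measure.sub_add_eq_sub_add ρ σ
    rw [h0, zero_add] at hadd
    have hle : ρ ≤ σ := hadd ▸ Measure.le_add_left le_rfl
    exact h (Measure.eq_of_le_of_isProbabilityMeasure hle)
  by_contra h
  have : NeZero (μ - ν) := ⟨hne h⟩
  have : NeZero (ν - μ) := ⟨hne (Ne.symm h)⟩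
  have hμν : P.IsInvariant (μ - ν) := fun t => (hμ t).sub (hν t)
  have hνμ : P.IsInvariant (ν - μ) := fun t => (hν t).sub (hμ t)
  refine P.not_mutuallySingular_of_isInvariant hirr F hASF hF _ _
    (hμν.smul ((μ - ν) Set.univ)⁻¹) (hνμ.smul ((ν - μ) Set.univ)⁻¹) ?_
  exact ((Measure.mutually_singular_measure_sub.smul _).symm.smul _).symm
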